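/- Let $R$ be a commutative ring with unit containing $\mathbb{Q}$, let $n\ge 0$, and let $F=(F_i)_{1\le i\le n}$ be a system of $n$ formal power series $F_i\in R[[X_1,\ldots,X_n]]$ without constant term. Let $A=(A_{ij})$, $A_{ij}=\left.\frac{\partial F_i}{\partial X_j}\right|_{X=0}$, be the matrix of the linear part $L_i(X)=\sum_j A_{ij}X_j$, assume that $A\in GL_n(R)$, and write $F_i=L_i-H_i$, where $-H_i$ is the sum of the terms of $F_i$ of total degree at least $2$. Let $\overline u=(\overline u_1,\ldots,\overline u_n)$, $u=(u_1,\ldots,u_n)$, $Y=(Y_1,\ldots,Y_n)$ be vectors of indeterminates, and write $\overline u H(u)=\sum_i \overline u_i H_i(u)$, $\overline u Y=\sum_i\overline u_iY_i$. For multiindices $\alpha_1,\alpha_2\in\mathbb{N}^n$ define $$\int d\overline u\,du\; e^{-\overline uAu}\;\overline u^{\alpha_1}u^{\alpha_2}:=(\det A)^{-1}\sum_{\sigma}\prod_{k=1}^{|\alpha_1|}\left[A^{-1}\right]_{\tau_2(\sigma(k))\,\tau_1(k)}\in R,$$ where $\tau_1:\{1,\ldots,|\alpha_1|\}\to\{1,\ldots,n\}$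 and $\tau_2:\{1,\ldots,|\alpha_2|\}\to\{1,\ldots,n\}$ are any maps that take each value $i$ exactly $(\alpha_1)_i$, respectively $(\alpha_2)_i$, times, and $\sigma$ runs over all bijections $\{1,\ldots,|\alpha_1|\}\to\{1,\ldots,|\alpha_2|\}$ (so the value is $0$ if $|\alpha_1|\ne|\alpha_2|$). For $U=\sum c_{\alpha_1,\alpha_2,\alpha_3}\overline u^{\alpha_1}u^{\alpha_2}Y^{\alpha_3}\in R[[\overline u,u,Y]]$ the formal Gaussian integral is $$\int d\overline u\,du\; e^{-\overline uAu}\;U:=\sum_{\alpha_1,\alpha_2,\alpha_3}c_{\alpha_1,\alpha_2,\alpha_3}\,Y^{\alpha_3}\int d\overline u\,du\; e^{-\overline uAu}\;\overline u^{\alpha_1}u^{\alpha_2}\in R[[Y]],$$ provided that this is summable in $R[[Y]]$, i.e. that for each $\alpha_3$ only finitely many $(\alpha_1,\alpha_2)$ give a nonzero contribution. Then the formal Gaussian integrals of $e^{\overline uH(u)+\overline uY}$ and, for every $1\le i\le n$, of $u_ie^{\overline uH(u)+\overline uY}$ are summable in $R[[Y]]$; the former is invertible in $R[[Y]]$; the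 system $F$ has a unique compositional inverse $F^{-1}$ (a system of $n$ power series without constant term with $F(F^{-1}(Y))=Y$ and $F^{-1}(F(X))=X$); and for every $1\le i\le n$ $$(F^{-1})_i(Y)=\frac{\displaystyle\int d\overline u\,du\; e^{-\overline uAu}\;u_i\,e^{\overline uH(u)+\overline uY}}{\displaystyle\int d\overline u\,du\; e^{-\overline uAu}\;e^{\overline uH(u)+\overline uY}}\quad\text{in }R[[Y]].$$ -/

import Mathlib

noncomputable section

namespace FormalGauss

variable {R : Type*} [CommRing R] {n : ℕ}

/-- `G` is the compositional inverse of `F`: both systems have no constant term and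
`F(G(Y)) = Y`, `G(F(X)) = X`. -/
structure IsCompInverse (F G : Fin n → MvPowerSeries (Fin n) R) : Prop where
  constantCoeff_left : ∀ i, MvPowerSeries.constantCoeff (F i) = 0
  constantCoeff_right : ∀ i, MvPowerSeries.constantCoeff (G i) = 0
  comp_left : ∀ i, (F i).subst G = (MvPowerSeries.X i : MvPowerSeries (Fin n) R)
  comp_right : ∀ i, (G i).subst F = (MvPowerSeries.X i : MvPowerSeries (Fin n) R)

/-- The matrix `A` of the linear part of `F`: `A i j = ∂F_i/∂X_j` at `X = 0`. -/
def linMatrix (F : Fin n → MvPowerSeries (Fin n) R) : Matrix (Fin n) (Fin n) R :=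
  Matrix.of fun i j => MvPowerSeries.coeff (Finsupp.single j 1) (F i)

/-- The linear part `L_i(X) = ∑ j, A i j * X_j`. -/
def linPart (F : Fin n → MvPowerSeries (Fin n) R) (i : Fin n) : MvPowerSeries (Fin n) R :=
  ∑ j, MvPowerSeries.C (linMatrix F i j) * MvPowerSeries.X j

/-- The nonlinear part `H`: minus the sum of the terms of `F` of total degree at least two. -/
def nonlinPart (F : Fin n → MvPowerSeries (Fin n) R) (i : Fin n) : MvPowerSeries (Fin n) R :=
  fun d => if 2 ≤ d.degree then -MvPowerSeries.coeff d (F i) else 0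

/-- For `F` without constant term, `F = L - H`. -/
theorem eq_linPart_sub_nonlinPart (F : Fin n → MvPowerSeries (Fin n) R)
    (hF : ∀ i, MvPowerSeries.constantCoeff (F i) = 0) (i : Fin n) :
    F i = linPart F i - nonlinPart F i := by
  classical
  ext d
  have hlin : MvPowerSeries.coeff d (linPart F i) =
      ∑ j, if d = Finsupp.single j 1 then linMatrix F i j else 0 := by
    simp [linPart, MvPowerSeries.coeff_X]
  have hnon : MvPowerSeries.coeff d (nonlinPart F i) =
      if 2 ≤ d.degree then -MvPowerSeries.coeff d (F i) else 0 := rfl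
  rw [map_sub, hlin, hnon]
  by_cases h2 : 2 ≤ d.degree
  · rw [if_pos h2, Finset.sum_eq_zero]
    · simp
    · intro j _
      rw [if_neg]
      rintro rfl
      simp at h2
  · rw [if_neg h2, sub_zero]
    have h01 : d.degree = 0 ∨ d.degree = 1 := by omega
    rcases h01 with h | h
    · obtain rfl := (Finsupp.degree_eq_zero_iff d).1 h
      rw [Finset.sum_eq_zero]
      · simpa using hF i
      · intro j _
        rw [if_neg]
        intro hj
        simpa using DFunLike.congr_fun hj j
    · obtain ⟨j, rfl⟩ := (Finsupp.sum_eq_one_iff d).1 h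
      rw [Finset.sum_eq_single j]
      · simp [linMatrix]
      · intro k _ hk
        rw [if_neg]
        intro he
        exact hk ((Finsupp.single_left_injective one_ne_zero he).symm)
      · simp

/-- The indeterminates of `R[[ū, u, Y]]`, in this order. -/
abbrev Vars (n : ℕ) : Type := Fin n ⊕ Fin n ⊕ Fin n

/-- The indeterminate `ū_i` of `R[[ū, u, Y]]`. -/
def ubar (R : Type*) [CommRing R] {n : ℕ} (i : Fin n) : MvPowerSeries (Vars n) R :=
  MvPowerSeries.X (Sum.inl i)

/-- The indeterminate `u_i` of `R[[ū, u, Y]]`. -/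
def uvar (R : Type*) [CommRing R] {n : ℕ} (i : Fin n) : MvPowerSeries (Vars n) R :=
  MvPowerSeries.X (Sum.inr (Sum.inl i))

/-- The indeterminate `Y_i` of `R[[ū, u, Y]]`. -/
def yvar (R : Type*) [CommRing R] {n : ℕ} (i : Fin n) : MvPowerSeries (Vars n) R :=
  MvPowerSeries.X (Sum.inr (Sum.inr i))

/-- The interaction `ūH(u) + ūY = ∑ i, ū_i H_i(u) + ∑ i, ū_i Y_i`. -/
def interaction (F : Fin n → MvPowerSeries (Fin n) R) : MvPowerSeries (Vars n) R :=
  ∑ i, ubar R i * (nonlinPart F i).subst (uvar R : Fin n → MvPowerSeries (Vars n) R) +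
    ∑ i, ubar R i * yvar R i

/-- `exp (ūH(u) + ūY)` in `R[[ū, u, Y]]`. -/
def expInteraction [Algebra ℚ R] (F : Fin n → MvPowerSeries (Fin n) R) :
    MvPowerSeries (Vars n) R :=
  (PowerSeries.exp R).subst (interaction F)

/-- `I_A(τ₁, τ₂) = ∑ σ, ∏ k, A⁻¹ (τ₂ (σ k)) (τ₁ k)`, the sum being over all bijections `σ` between
the (finite) domains of `τ₁` and `τ₂`; it is zero if there are none. -/
def wickSum (A : Matrix (Fin n) (Fin n) R) {ι κ : Type*} [Fintype ι] [Fintype κ]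
    [DecidableEq ι] [DecidableEq κ] (τ₁ : ι → Fin n) (τ₂ : κ → Fin n) : R :=
  ∑ σ : ι ≃ κ, ∏ k, A⁻¹ (τ₂ (σ k)) (τ₁ k)

/-- The formal Gaussian integral of the monomial `ū^α₁ u^α₂` with covariance `A⁻¹`:
`(det A)⁻¹ * I_A(τ₁, τ₂)` for maps `τ₁`, `τ₂` with multiplicity multiindices `α₁`, `α₂`. The
canonical such maps are used here; `gaussMonomial_eq` shows that any others give the same. -/
def gaussMonomial (A : Matrix (Fin n) (Fin n) R) (α₁ α₂ : Fin n →₀ ℕ) : R :=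
  Ring.inverse A.det *
    wickSum A (fun p : (Σ i : Fin n, Fin (α₁ i)) => p.1) (fun p : (Σ i : Fin n, Fin (α₂ i)) => p.1)

/-- The value does not depend on the choice of `τ₁ : [k₁] → [n]` and `τ₂ : [k₂] → [n]`. -/
theorem gaussMonomial_eq (A : Matrix (Fin n) (Fin n) R) (α₁ α₂ : Fin n →₀ ℕ) {k₁ k₂ : ℕ}
    (τ₁ : Fin k₁ → Fin n) (τ₂ : Fin k₂ → Fin n)
    (h₁ : ∀ i, (Finset.univ.filter fun k => τ₁ k = i).card = α₁ i)
    (h₂ : ∀ i, (Finset.univ.filter fun k => τ₂ k = i).card = α₂ i) :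
    gaussMonomial A α₁ α₂ = Ring.inverse A.det * wickSum A τ₁ τ₂ := by
  classical
  have key : ∀ (α : Fin n →₀ ℕ) (k : ℕ) (τ : Fin k → Fin n),
      (∀ i, (Finset.univ.filter fun k => τ k = i).card = α i) →
      ∃ e : Fin k ≃ (Σ i : Fin n, Fin (α i)), ∀ x, (e x).1 = τ x := by
    intro α k τ h
    refine ⟨(Equiv.sigmaFiberEquiv τ).symm.trans (Equiv.sigmaCongrRight fun i =>
      Fintype.equivFinOfCardEq ((Fintype.card_subtype _).trans (h i))), fun x => rfl⟩
  obtain ⟨e₁, he₁⟩ := key α₁ k₁ τ₁ h₁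
  obtain ⟨e₂, he₂⟩ := key α₂ k₂ τ₂ h₂
  unfold gaussMonomial wickSum
  congr 1
  refine (Fintype.sum_equiv (Equiv.equivCongr e₁ e₂) _ _ fun σ => ?_).symm
  refine Fintype.prod_equiv e₁ _ _ fun k => ?_
  simp [he₁, he₂]

/-- The coefficient of `Y^α₃` in the contribution of the multiindices `(α₁, α₂)` to the formal
Gaussian integral of `U`. -/
def gaussTerm (A : Matrix (Fin n) (Fin n) R) (U : MvPowerSeries (Vars n) R)
    (α₃ : Fin n →₀ ℕ) (α : (Fin n →₀ ℕ) × (Fin n →₀ ℕ)) : R :=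
  MvPowerSeries.coeff (Finsupp.sumElim α.1 (Finsupp.sumElim α.2 α₃)) U * gaussMonomial A α.1 α.2

/-- Summability in `R[[Y]]` of the formal Gaussian integral of `U`: for every `α₃`, only finitely
many `(α₁, α₂)` give a nonzero contribution. -/
def GaussSummable (A : Matrix (Fin n) (Fin n) R) (U : MvPowerSeries (Vars n) R) : Prop :=
  ∀ α₃ : Fin n →₀ ℕ, {α | gaussTerm A U α₃ α ≠ 0}.Finite

/-- The formal Gaussian integral `∫ dū du e^{-ūAu} U`, an element of `R[[Y]]`
(meaningful if `GaussSummable A U`). -/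
def gaussIntegral (A : Matrix (Fin n) (Fin n) R) (U : MvPowerSeries (Vars n) R) :
    MvPowerSeries (Fin n) R :=
  fun α₃ => ∑ᶠ α, gaussTerm A U α₃ α

end FormalGauss

end

/-! Write `⟨V⟩` for the Gaussian integral of `V · exp(ūH(u) + ūY)`. Integration by parts in `ū_j`
turns the derivative into the factor `∑ k, A j k u_k`, while the derivative of the exponential
brings down `H_j(u) + Y_j`. Since `Au - H(u) = F(u)`, this gives the Schwinger–Dyson equation
`⟨F_j(u) Q(u)⟩ = Y_j ⟨Q(u)⟩` (`gaussMoment_mul_left`). By induction `⟨p(F(u))⟩ = p(Y) ⟨1⟩` for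
polynomials `p`, and by truncation for all power series (`gaussMoment_subst`). For `p = (F⁻¹)_i` the
left side is `⟨u_i⟩`, which is the claim once `⟨1⟩` is divided out; its constant term is `(det
A)⁻¹`, a unit.

Integration by parts is Wick's recursion on monomials (`sum_mul_gaussMonomial`), extended to series
by `gaussIntegral_pderiv`. Summability and truncation both rest on a grading with weights `-2, 1, 2`
for `ū, u, Y`: the exponential has weight at least `0`, and only monomials of equal degree in `ū`
and `u` contribute. The inverse itself is the fixed point of `G = A⁻¹(X + H(G))`, a contraction for
the order filtration. -/

namespace FormalGauss

open MvPowerSeries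

/-! ### The order filtration and its behaviour under substitution. -/

section Order

variable {R : Type*} [CommRing R] {σ τ : Type*}

/-- The ideal of power series of order at least `k`. -/
def orderIdeal (R : Type*) [CommRing R] (σ : Type*) (k : ℕ∞) : Ideal (MvPowerSeries σ R) where
  carrier := {f | k ≤ f.order}
  add_mem' hf hg := (le_min hf hg).trans min_order_le_add
  zero_mem' := by simp
  smul_mem' c _ hf := (le_add_left hf).trans (le_order_mul (f := c))

theorem mem_orderIdeal {k : ℕ∞} {f : MvPowerSeries σ R} : f ∈ orderIdeal R σ k ↔ k ≤ f.order :=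
  Iff.rfl

theorem orderIdeal_mono {k l : ℕ∞} (h : k ≤ l) : orderIdeal R σ l ≤ orderIdeal R σ k :=
  fun _ hf => h.trans hf

theorem mem_orderIdeal_of_constantCoeff_eq_zero {f : MvPowerSeries σ R}
    (hf : constantCoeff f = 0) : f ∈ orderIdeal R σ 1 :=
  one_le_order_iff_constCoeff_eq_zero.2 hf

theorem mul_mem_orderIdeal {k l : ℕ∞} {f g : MvPowerSeries σ R}
    (hf : f ∈ orderIdeal R σ k) (hg : g ∈ orderIdeal R σ l) : f * g ∈ orderIdeal R σ (k + l) :=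
  (add_le_add (mem_orderIdeal.1 hf) (mem_orderIdeal.1 hg)).trans le_order_mul

theorem eq_of_forall_sub_mem_orderIdeal {f g : MvPowerSeries σ R}
    (h : ∀ k : ℕ, f - g ∈ orderIdeal R σ k) : f = g := by
  ext d
  rw [← sub_eq_zero, ← map_sub]
  exact coeff_of_lt_order
    ((Nat.cast_lt.2 d.degree.lt_succ_self).trans_le (h _))

/-- Congruence modulo an ideal is preserved by products and powers. -/
theorem prod_pow_sub_mem_orderIdeal {a b : σ → MvPowerSeries τ R} {k : ℕ}
    (hab : ∀ i, a i - b i ∈ orderIdeal R τ k) (e : σ →₀ ℕ) :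
    (e.prod fun i m => a i ^ m) - (e.prod fun i m => b i ^ m) ∈ orderIdeal R τ k := by
  rw [← Ideal.Quotient.eq]
  simp only [Finsupp.prod, map_prod, map_pow]
  exact Finset.prod_congr rfl fun i _ => by rw [Ideal.Quotient.eq.2 (hab i)]

theorem prod_pow_mem_orderIdeal {a : σ → MvPowerSeries τ R}
    (ha : ∀ i, constantCoeff (a i) = 0) (e : σ →₀ ℕ) :
    (e.prod fun i m => a i ^ m) ∈ orderIdeal R τ e.degree := by
  rw [mem_orderIdeal, Finsupp.prod]
  refine le_trans ?_ (le_order_prod _ e.support)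
  rw [Finsupp.degree_apply]
  push_cast
  exact Finset.sum_le_sum fun i _ => le_order_pow_of_constantCoeff_eq_zero _ (ha i)

/-- Two substitutions that agree below degree `k` agree below degree `k + 1` after a power series
without terms of degree less than two. -/
theorem subst_sub_subst_mem_orderIdeal [Finite σ] {H : MvPowerSeries σ R}
    (hH : H ∈ orderIdeal R σ 2) {a b : σ → MvPowerSeries τ R}
    (ha : ∀ i, constantCoeff (a i) = 0) (hb : ∀ i, constantCoeff (b i) = 0) {k : ℕ}
    (hab : ∀ i, a i - b i ∈ orderIdeal R τ k) :
    H.subst a - H.subst b ∈ orderIdeal R τ ((k + 1 : ℕ) : ℕ∞) := by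
  refine nat_le_order fun d hd => ?_
  rw [map_sub, sub_eq_zero, coeff_subst (hasSubst_of_constantCoeff_zero ha),
    coeff_subst (hasSubst_of_constantCoeff_zero hb)]
  refine finsum_congr fun e => ?_
  by_cases he : coeff e H = 0
  · simp [he]
  have hdeg : 2 ≤ e.degree := by
    exact_mod_cast (mem_orderIdeal.1 hH).trans (order_le he)
  congr 1
  rw [← sub_eq_zero, ← map_sub]
  refine coeff_of_lt_order ((Nat.cast_lt.2 hd).trans_le ?_)
  change _ ∈ orderIdeal R τ _
  have hne : e ≠ 0 := by rintro rfl; simp at hdeg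
  obtain ⟨i, hi⟩ := Finsupp.support_nonempty_iff.2 hne
  have hi' : Finsupp.single i 1 ≤ e := by
    simpa [Finsupp.single_le_iff, Nat.one_le_iff_ne_zero] using hi
  obtain ⟨e', rfl⟩ := exists_add_of_le hi'
  have hdeg' : 1 ≤ e'.degree := by
    rw [map_add, Finsupp.degree_single] at hdeg; omega
  have hsplit : ∀ c : σ → MvPowerSeries τ R,
      ((Finsupp.single i 1 + e').prod fun i m => c i ^ m) =
        (e'.prod fun i m => c i ^ m) * c i := fun c => by
    rw [Finsupp.prod_add_index' (by simp) (by simp [pow_add]),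
      Finsupp.prod_single_index (by simp), pow_one, mul_comm]
  -- After one factor is split off, each summand gains a degree over `k`: in `p * (x - y)` the
  -- factor `p` has order at least one, in `(p - q) * y` the factor `y` has.
  rw [hsplit, hsplit, show ∀ p q x y : MvPowerSeries τ R,
    p * x - q * y = p * (x - y) + (p - q) * y from fun _ _ _ _ => by ring]
  push_cast
  refine add_mem ?_ ?_
  · rw [add_comm]
    exact mul_mem_orderIdeal
      (show (1 : ℕ∞) ≤ _ from (by exact_mod_cast hdeg' : (1 : ℕ∞) ≤ e'.degree).trans
        (prod_pow_mem_orderIdeal ha e')) (hab i)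
  · exact mul_mem_orderIdeal (prod_pow_sub_mem_orderIdeal hab e')
      (mem_orderIdeal_of_constantCoeff_eq_zero (hb i))

end Order

/-! ### Existence and uniqueness of the compositional inverse. -/

section CompInverse

variable {R : Type*} [CommRing R] {n : ℕ} {F : Fin n → MvPowerSeries (Fin n) R}

theorem nonlinPart_mem_orderIdeal (F : Fin n → MvPowerSeries (Fin n) R) (i : Fin n) :
    nonlinPart F i ∈ orderIdeal R (Fin n) 2 :=
  nat_le_order (n := 2) fun _ hd => if_neg (not_le.2 hd)

theorem subst_eq_sum_sub {τ : Type*} (hF : ∀ i, constantCoeff (F i) = 0)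
    {a : Fin n → MvPowerSeries τ R} (ha : ∀ i, constantCoeff (a i) = 0) (i : Fin n) :
    (F i).subst a = ∑ j, C (linMatrix F i j) * a j - (nonlinPart F i).subst a := by
  have hs := hasSubst_of_constantCoeff_zero ha
  conv_lhs => rw [eq_linPart_sub_nonlinPart F hF i, linPart, subst_sub hs]
  rw [← substAlgHom_apply hs, map_sum]
  simp only [map_mul, substAlgHom_apply, subst_C, subst_X hs]

/-- If `F(a)` is given, then `a` is recovered from `F(a)` and `H(a)`. -/
theorem eq_sum_inv_mul {τ : Type*} (hF : ∀ i, constantCoeff (F i) = 0)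
    (hA : IsUnit (linMatrix F)) {a : Fin n → MvPowerSeries τ R}
    (ha : ∀ i, constantCoeff (a i) = 0) (i : Fin n) :
    a i = ∑ j, C ((linMatrix F)⁻¹ i j) * ((F j).subst a + (nonlinPart F j).subst a) := by
  simp only [subst_eq_sum_sub hF ha, sub_add_cancel, Finset.mul_sum]
  rw [Finset.sum_comm]
  simp only [← mul_assoc, ← map_mul, ← Finset.sum_mul, ← map_sum, ← Matrix.mul_apply,
    Matrix.nonsing_inv_mul _ ((Matrix.isUnit_iff_isUnit_det _).1 hA), Matrix.one_apply]
  simp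

/-- A system with invertible linear part is left cancellable under composition. -/
theorem subst_left_cancel {τ : Type*} (hF : ∀ i, constantCoeff (F i) = 0)
    (hA : IsUnit (linMatrix F)) {a b : Fin n → MvPowerSeries τ R}
    (ha : ∀ i, constantCoeff (a i) = 0) (hb : ∀ i, constantCoeff (b i) = 0)
    (hab : ∀ i, (F i).subst a = (F i).subst b) : a = b := by
  have key : ∀ k : ℕ, ∀ i, a i - b i ∈ orderIdeal R τ k := by
    intro k
    induction k with
    | zero => intro i; simp [mem_orderIdeal]
    | succ k ih =>
      intro i
      rw [eq_sum_inv_mul hF hA ha i, eq_sum_inv_mul hF hA hb i, ← Finset.sum_sub_distrib]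
      refine sum_mem fun j _ => ?_
      rw [← mul_sub, hab j, add_sub_add_left_eq_sub]
      exact Ideal.mul_mem_left _ _
        (subst_sub_subst_mem_orderIdeal (nonlinPart_mem_orderIdeal F j) ha hb ih)
  exact funext fun i => eq_of_forall_sub_mem_orderIdeal fun k => key k i

/-- The map `G ↦ A⁻¹ (X + H(G))`, whose fixed point is the compositional inverse. -/
noncomputable def invStep (F G : Fin n → MvPowerSeries (Fin n) R) (i : Fin n) :
    MvPowerSeries (Fin n) R :=
  ∑ j, C ((linMatrix F)⁻¹ i j) * (X j + (nonlinPart F j).subst G)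

theorem constantCoeff_nonlinPart (F : Fin n → MvPowerSeries (Fin n) R) (i : Fin n) :
    constantCoeff (nonlinPart F i) = 0 :=
  one_le_order_iff_constCoeff_eq_zero.1
    ((by norm_num : (1 : ℕ∞) ≤ 2).trans (nonlinPart_mem_orderIdeal F i))

theorem constantCoeff_invStep {G : Fin n → MvPowerSeries (Fin n) R}
    (hG : ∀ i, constantCoeff (G i) = 0) (i : Fin n) : constantCoeff (invStep F G i) = 0 := by
  have h : ∀ j, constantCoeff ((nonlinPart F j).subst G) = 0 := fun j =>
    constantCoeff_subst_eq_zero (hasSubst_of_constantCoeff_zero hG) hG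
      (constantCoeff_nonlinPart F j)
  simp [invStep, h]

theorem invStep_sub_mem_orderIdeal {a b : Fin n → MvPowerSeries (Fin n) R}
    (ha : ∀ i, constantCoeff (a i) = 0) (hb : ∀ i, constantCoeff (b i) = 0) {k : ℕ}
    (hab : ∀ i, a i - b i ∈ orderIdeal R (Fin n) k) (i : Fin n) :
    invStep F a i - invStep F b i ∈ orderIdeal R (Fin n) ((k + 1 : ℕ) : ℕ∞) := by
  rw [invStep, invStep, ← Finset.sum_sub_distrib]
  refine sum_mem fun j _ => ?_
  rw [← mul_sub, add_sub_add_left_eq_sub]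
  exact Ideal.mul_mem_left _ _
    (subst_sub_subst_mem_orderIdeal (nonlinPart_mem_orderIdeal F j) ha hb hab)

/-- Each application of `invStep` improves agreement by one degree, so the iterates starting from
`0` stabilise coefficientwise and their limit is fixed. -/
theorem exists_invStep_eq (F : Fin n → MvPowerSeries (Fin n) R) :
    ∃ G : Fin n → MvPowerSeries (Fin n) R,
      (∀ i, constantCoeff (G i) = 0) ∧ invStep F G = G := by
  let s : ℕ → Fin n → MvPowerSeries (Fin n) R := fun k => (invStep F)^[k] 0
  have hs : ∀ k, s (k + 1) = invStep F (s k) := fun k => Function.iterate_succ_apply' _ _ _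
  have hs0 : ∀ k i, constantCoeff (s k i) = 0 := by
    intro k
    induction k with
    | zero => intro i; simp [s]
    | succ k ih => rw [hs]; exact constantCoeff_invStep ih
  have hstep : ∀ (k : ℕ) i, s (k + 1) i - s k i ∈ orderIdeal R (Fin n) k := by
    intro k
    induction k with
    | zero => intro i; simp [mem_orderIdeal]
    | succ k ih =>
      rw [hs (k + 1)]
      conv => enter [i, 2, 2]; rw [hs k]
      exact invStep_sub_mem_orderIdeal (hs0 _) (hs0 _) ih
  have hcauchy : ∀ (k m : ℕ) i, s (k + m) i - s k i ∈ orderIdeal R (Fin n) k := by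
    intro k m i
    induction m with
    | zero => simp
    | succ m ih =>
      have h : s (k + m + 1) i - s (k + m) i ∈ orderIdeal R (Fin n) k :=
        orderIdeal_mono (Nat.cast_le.2 (Nat.le_add_right k m)) (hstep (k + m) i)
      simpa [add_assoc] using add_mem h ih
  -- All iterates from the `k`-th on agree below degree `k`, so the coefficient at `d` is final from
  -- `k = d.degree + 1` on.
  let G : Fin n → MvPowerSeries (Fin n) R := fun i d => coeff d (s (d.degree + 1) i)
  have hG : ∀ (k : ℕ) i, G i - s k i ∈ orderIdeal R (Fin n) k := by
    intro k i
    refine nat_le_order fun d hd => ?_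
    obtain ⟨m, rfl⟩ := Nat.exists_eq_add_of_le (Nat.succ_le_of_lt hd)
    have h : coeff d (s (d.degree + 1 + m) i - s (d.degree + 1) i) = 0 :=
      coeff_of_lt_order ((Nat.cast_lt.2 d.degree.lt_succ_self).trans_le (hcauchy _ m i))
    rw [map_sub, sub_eq_zero] at h ⊢
    exact h.symm
  have hG0 : ∀ i, constantCoeff (G i) = 0 := fun i => by
    have h := hG 1 i
    rw [mem_orderIdeal, Nat.cast_one, one_le_order_iff_constCoeff_eq_zero, map_sub, hs0,
      sub_zero] at h
    exact h
  refine ⟨G, hG0, funext fun i => eq_of_forall_sub_mem_orderIdeal fun k => ?_⟩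
  have h1 : invStep F G i - invStep F (s k) i ∈ orderIdeal R (Fin n) k :=
    orderIdeal_mono (Nat.cast_le.2 k.le_succ) (invStep_sub_mem_orderIdeal hG0 (hs0 k) (hG k) i)
  have h2 : G i - s (k + 1) i ∈ orderIdeal R (Fin n) k :=
    orderIdeal_mono (Nat.cast_le.2 k.le_succ) (hG (k + 1) i)
  rw [hs] at h2
  simpa using sub_mem h1 h2

/-- The fixed point equation multiplied by `A` says `F(G) = X`. Then `F(G(F)) = F = F(X)`, and left
cancellation of `F` gives `G(F) = X`. -/
theorem exists_isCompInverse (hF : ∀ i, constantCoeff (F i) = 0) (hA : IsUnit (linMatrix F)) :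
    ∃ G, IsCompInverse F G := by
  obtain ⟨G, hG0, hG⟩ := exists_invStep_eq F
  have hright : ∀ i, (F i).subst G = (X i : MvPowerSeries (Fin n) R) := by
    intro i
    have h : ∑ j, C (linMatrix F i j) * G j = X i + (nonlinPart F i).subst G := by
      conv_lhs => rw [← hG]
      simp only [invStep, Finset.mul_sum]
      rw [Finset.sum_comm]
      simp only [← mul_assoc, ← map_mul, ← Finset.sum_mul, ← map_sum, ← Matrix.mul_apply,
        Matrix.mul_nonsing_inv _ ((Matrix.isUnit_iff_isUnit_det _).1 hA), Matrix.one_apply]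
      simp
    rw [subst_eq_sum_sub hF hG0, h, add_sub_cancel_right]
  refine ⟨G, hF, hG0, hright, fun i => ?_⟩
  have hsF := hasSubst_of_constantCoeff_zero hF
  have hsG := hasSubst_of_constantCoeff_zero hG0
  have h : (fun i => (G i).subst F) = (X : Fin n → MvPowerSeries (Fin n) R) := by
    refine subst_left_cancel hF hA
      (fun i => constantCoeff_subst_eq_zero hsF hF (hG0 i)) (by simp) fun i => ?_
    rw [← subst_comp_subst_apply hsG hsF, hright, subst_X hsF, subst_self, id]
  exact congrFun h i

theorem IsCompInverse.eq_of_isUnit_linMatrix (hA : IsUnit (linMatrix F))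
    {G G' : Fin n → MvPowerSeries (Fin n) R} (h : IsCompInverse F G) (h' : IsCompInverse F G') :
    G' = G :=
  subst_left_cancel h.constantCoeff_left hA h'.constantCoeff_right h.constantCoeff_right
    fun i => (h'.comp_left i).trans (h.comp_left i).symm

end CompInverse

/-! ### Wick sums and integration by parts on monomials. -/

section Wick

variable {R : Type*} [CommRing R] {n : ℕ} (A : Matrix (Fin n) (Fin n) R)
  {ι κ : Type*} [Fintype ι] [Fintype κ] [DecidableEq ι] [DecidableEq κ]

theorem wickSum_eq_sum_symm (τ₁ : ι → Fin n) (τ₂ : κ → Fin n) :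
    wickSum A τ₁ τ₂ = ∑ σ : κ ≃ ι, ∏ k, A⁻¹ (τ₂ k) (τ₁ (σ k)) :=
  Fintype.sum_equiv (Equiv.symmEquiv ι κ) _ _ fun σ =>
    Fintype.prod_equiv σ _ _ fun k => by simp

/-- Expansion of the Wick sum along one of the `u`'s. -/
theorem wickSum_option (τ₁ : ι → Fin n) (τ₂ : Option κ → Fin n) :
    wickSum A τ₁ τ₂ = ∑ p, A⁻¹ (τ₂ none) (τ₁ p) *
      wickSum A (fun x : {x // x ≠ p} => τ₁ x) (fun x => τ₂ (some x)) := by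
  rw [wickSum_eq_sum_symm,
    ← Finset.sum_fiberwise Finset.univ (fun σ : Option κ ≃ ι => σ none)]
  refine Finset.sum_congr rfl fun p _ => ?_
  rw [wickSum_eq_sum_symm, Finset.mul_sum,
    Finset.sum_subtype (p := fun σ : Option κ ≃ ι => σ none = p) _ (by simp)]
  -- Bijections sending `none` to `p` are the same as bijections of `κ` with the complement of `p`.
  refine Fintype.sum_equiv (Equiv.optionSubtype p) _ _ fun σ => ?_
  rw [Fintype.prod_option, σ.2]
  rfl

theorem exists_equiv_of_card_fiber {ι κ : Type*} [Fintype ι] [Fintype κ]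
    (τ : ι → Fin n) (τ' : κ → Fin n)
    (h : ∀ i, (Finset.univ.filter fun k => τ k = i).card =
      (Finset.univ.filter fun k => τ' k = i).card) :
    ∃ e : ι ≃ κ, ∀ x, τ' (e x) = τ x := by
  refine ⟨(Equiv.sigmaFiberEquiv τ).symm.trans ((Equiv.sigmaCongrRight fun i =>
    Fintype.equivOfCardEq (by simpa [Fintype.card_subtype] using h i)).trans
      (Equiv.sigmaFiberEquiv τ')), fun x => ?_⟩
  exact (Fintype.equivOfCardEq (α := {y // τ y = τ x}) (β := {y // τ' y = τ x}) _ ⟨x, rfl⟩).2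

/-- Only the fiber sizes of the two maps matter; this permits changing index types after one element
is added or removed. -/
theorem wickSum_congr {ι' κ' : Type*} [Fintype ι'] [Fintype κ'] [DecidableEq ι'] [DecidableEq κ']
    {τ₁ : ι → Fin n} {τ₂ : κ → Fin n} {τ₁' : ι' → Fin n} {τ₂' : κ' → Fin n}
    (h₁ : ∀ i, (Finset.univ.filter fun k => τ₁ k = i).card =
      (Finset.univ.filter fun k => τ₁' k = i).card)
    (h₂ : ∀ i, (Finset.univ.filter fun k => τ₂ k = i).card =
      (Finset.univ.filter fun k => τ₂' k = i).card) :
    wickSum A τ₁ τ₂ = wickSum A τ₁' τ₂' := by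
  obtain ⟨e₁, he₁⟩ := exists_equiv_of_card_fiber τ₁ τ₁' h₁
  obtain ⟨e₂, he₂⟩ := exists_equiv_of_card_fiber τ₂ τ₂' h₂
  refine Fintype.sum_equiv (Equiv.equivCongr e₁ e₂) _ _ fun σ => ?_
  refine Fintype.prod_equiv e₁ _ _ fun k => ?_
  simp [he₁, he₂]

theorem card_filter_sigma_fst (α : Fin n →₀ ℕ) (i : Fin n) :
    (Finset.univ.filter fun p : (Σ i : Fin n, Fin (α i)) => p.1 = i).card = α i := by
  rw [← Fintype.card_subtype, Fintype.card_congr (Equiv.sigmaSubtype i), Fintype.card_fin]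

/-- Wick's recursion: integration by parts on monomials. -/
theorem sum_mul_gaussMonomial (hA : IsUnit A) (j : Fin n) (α₁ α₂ : Fin n →₀ ℕ) :
    ∑ k, A j k * gaussMonomial A α₁ (α₂ + Finsupp.single k 1) =
      α₁ j * gaussMonomial A (α₁ - Finsupp.single j 1) α₂ := by
  set τ₁ : (Σ i : Fin n, Fin (α₁ i)) → Fin n := fun p => p.1 with hτ₁
  set τ₂ : (Σ i : Fin n, Fin (α₂ i)) → Fin n := fun p => p.1 with hτ₂
  have h1 : ∀ k, gaussMonomial A α₁ (α₂ + Finsupp.single k 1) =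
      Ring.inverse A.det * wickSum A τ₁ (fun o : Option (Σ i : Fin n, Fin (α₂ i)) => o.elim k τ₂) := by
    intro k
    refine congrArg (Ring.inverse A.det * ·) (wickSum_congr A (fun i => rfl) fun i => ?_)
    have h := card_filter_sigma_fst α₂ i
    rw [Finset.card_filter] at h
    rw [card_filter_sigma_fst, Finset.card_filter, Fintype.sum_option]
    simp only [Option.elim_none, Option.elim_some, hτ₂, h, Finsupp.add_apply,
      Finsupp.single_apply, add_comm]
  have h2 : ∀ p, τ₁ p = j →
      wickSum A (fun x : {x // x ≠ p} => τ₁ x) τ₂ =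
        wickSum A (fun p : (Σ i : Fin n, Fin ((α₁ - Finsupp.single j 1 : Fin n →₀ ℕ) i)) => p.1) τ₂ := by
    intro p hp
    refine wickSum_congr A (fun i => ?_) fun i => rfl
    rw [card_filter_sigma_fst]
    have h : (Finset.univ.filter fun p => τ₁ p = i).card = α₁ i := card_filter_sigma_fst α₁ i
    rw [Finset.card_filter, ← Finset.add_sum_erase _ _ (Finset.mem_univ p)] at h
    rw [Finset.card_filter, ← Finset.sum_subtype (Finset.univ.erase p) (by simp)
      (fun x => if τ₁ x = i then 1 else 0)]
    simp only [Finsupp.tsub_apply, Finsupp.single_apply, ← hp]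
    omega
  have hAA : A * A⁻¹ = 1 := Matrix.mul_nonsing_inv _ ((Matrix.isUnit_iff_isUnit_det _).1 hA)
  simp only [h1, wickSum_option, Option.elim_none, Option.elim_some, Finset.mul_sum]
  rw [Finset.sum_comm]
  -- Since `A * A⁻¹ = 1`, only the `p` with `τ₁ p = j` survive. There are `α₁ j` of them, all
  -- contributing the same value.
  have h3 : ∀ p, ∑ k, A j k * (Ring.inverse A.det * (A⁻¹ k (τ₁ p) *
      wickSum A (fun x : {x // x ≠ p} => τ₁ x) τ₂)) =
      if τ₁ p = j then gaussMonomial A (α₁ - Finsupp.single j 1) α₂ else 0 := by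
    intro p
    have h4 : ∑ k, A j k * A⁻¹ k (τ₁ p) = if τ₁ p = j then 1 else 0 := by
      rw [← Matrix.mul_apply, hAA, Matrix.one_apply]
      simp only [eq_comm]
    calc _ = (∑ k, A j k * A⁻¹ k (τ₁ p)) * (Ring.inverse A.det *
          wickSum A (fun x : {x // x ≠ p} => τ₁ x) τ₂) := by
          rw [Finset.sum_mul]
          exact Finset.sum_congr rfl fun k _ => by ring
      _ = _ := by
          rw [h4]
          split_ifs with hp
          · rw [one_mul, h2 p hp, gaussMonomial, hτ₂]
          · rw [zero_mul]
  rw [Finset.sum_congr rfl fun p _ => h3 p, ← Finset.sum_filter, Finset.sum_const,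
    card_filter_sigma_fst, nsmul_eq_mul]

end Wick

/-! ### Linearity and integration by parts for the formal integral. -/

section Integral

variable {R : Type*} [CommRing R] {n : ℕ} {A : Matrix (Fin n) (Fin n) R}
  {U V : MvPowerSeries (Vars n) R}

theorem gaussMonomial_eq_zero {α₁ α₂ : Fin n →₀ ℕ} (h : α₁.degree ≠ α₂.degree) :
    gaussMonomial A α₁ α₂ = 0 := by
  have : IsEmpty ((Σ i : Fin n, Fin (α₁ i)) ≃ (Σ i : Fin n, Fin (α₂ i))) := by
    refine ⟨fun e => h ?_⟩
    simpa [Finsupp.degree_eq_sum] using Fintype.card_congr e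
  simp [gaussMonomial, wickSum]

theorem coeff_gaussIntegral (α₃ : Fin n →₀ ℕ) :
    coeff α₃ (gaussIntegral A U) = ∑ᶠ α, gaussTerm A U α₃ α := rfl

theorem gaussIntegral_add (hU : GaussSummable A U) (hV : GaussSummable A V) :
    gaussIntegral A (U + V) = gaussIntegral A U + gaussIntegral A V := by
  ext α₃
  rw [map_add]
  simp only [coeff_gaussIntegral]
  rw [← finsum_add_distrib (hU α₃) (hV α₃)]
  simp [gaussTerm, add_mul]

theorem gaussIntegral_C_mul (hU : GaussSummable A U) (r : R) :
    gaussIntegral A (C r * U) = C r * gaussIntegral A U := by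
  ext α₃
  rw [coeff_C_mul]
  simp only [coeff_gaussIntegral]
  rw [mul_finsum' _ _ (hU α₃)]
  simp [gaussTerm, mul_assoc]

theorem finsum_comp_of_support_subset_range {α β M : Type*} [AddCommMonoid M] {f : β → M}
    {g : α → β} (hg : Function.Injective g) (hs : ∀ b, f b ≠ 0 → b ∈ Set.range g) :
    ∑ᶠ b, f b = ∑ᶠ a, f (g a) := by
  rw [← finsum_mem_range hg, ← finsum_mem_univ f]
  exact finsum_mem_inter_support_eq' _ _ _ fun b hb => by simpa using hs b hb

theorem coeff_single_add_X_mul {σ : Type*} (i : σ) (d : σ →₀ ℕ) (f : MvPowerSeries σ R) :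
    coeff (d + Finsupp.single i 1) (X i * f) = coeff d f := by
  rw [X, add_comm, coeff_add_monomial_mul, one_mul]

theorem coeff_X_mul_eq_zero {σ : Type*} {i : σ} {d : σ →₀ ℕ} (h : d i = 0)
    (f : MvPowerSeries σ R) : coeff d (X i * f) = 0 := by
  classical
  rw [X, coeff_monomial_mul, if_neg]
  simp [Finsupp.single_le_iff, h]

theorem gaussIntegral_yvar_mul (j : Fin n) :
    gaussIntegral A (yvar R j * U) = X j * gaussIntegral A U := by
  ext α₃
  rw [coeff_gaussIntegral]
  by_cases h : α₃ j = 0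
  · rw [coeff_X_mul_eq_zero h, finsum_eq_zero_of_forall_eq_zero]
    intro α
    rw [gaussTerm, yvar, coeff_X_mul_eq_zero (by simpa using h), zero_mul]
  · obtain ⟨β, rfl⟩ : ∃ β, α₃ = β + Finsupp.single j 1 :=
      ⟨α₃ - Finsupp.single j 1, (tsub_add_cancel_of_le (by
        simpa [Finsupp.single_le_iff, Nat.one_le_iff_ne_zero] using h)).symm⟩
    rw [coeff_single_add_X_mul, coeff_gaussIntegral]
    refine finsum_congr fun α => ?_
    have : Finsupp.sumElim α.1 (Finsupp.sumElim α.2 (β + Finsupp.single j 1)) =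
        Finsupp.sumElim α.1 (Finsupp.sumElim α.2 β) +
          Finsupp.single (Sum.inr (Sum.inr j) : Vars n) 1 := by
      ext (i | i | i) <;> simp [Finsupp.single_apply]
    rw [gaussTerm, gaussTerm, yvar, this, coeff_single_add_X_mul]

theorem gaussTerm_uvar_mul (k : Fin n) (α₃ α₁ α₂ : Fin n →₀ ℕ) :
    gaussTerm A (uvar R k * U) α₃ (α₁, α₂ + Finsupp.single k 1) =
      coeff (Finsupp.sumElim α₁ (Finsupp.sumElim α₂ α₃)) U *
        gaussMonomial A α₁ (α₂ + Finsupp.single k 1) := by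
  have : Finsupp.sumElim α₁ (Finsupp.sumElim (α₂ + Finsupp.single k 1) α₃) =
      Finsupp.sumElim α₁ (Finsupp.sumElim α₂ α₃) +
        Finsupp.single (Sum.inr (Sum.inl k) : Vars n) 1 := by
    ext (i | i | i) <;> simp [Finsupp.single_apply]
  rw [gaussTerm, uvar, this, coeff_single_add_X_mul]

theorem sub_single_add_single {σ : Type*} {α : σ →₀ ℕ} {k : σ} (h : α k ≠ 0) :
    α - Finsupp.single k 1 + Finsupp.single k 1 = α :=
  tsub_add_cancel_of_le (by simpa [Finsupp.single_le_iff, Nat.one_le_iff_ne_zero] using h)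

/-- Integration by parts for the formal Gaussian integral. -/
theorem gaussIntegral_pderiv (hA : IsUnit A) (j : Fin n)
    (hU : ∀ k, GaussSummable A (uvar R k * U)) :
    gaussIntegral A (pderiv R (Sum.inl j) U) =
      ∑ k, C (A j k) * gaussIntegral A (uvar R k * U) := by
  ext α₃
  rw [map_sum]
  simp only [coeff_C_mul, coeff_gaussIntegral]
  have hinj : ∀ k : Fin n, Function.Injective
      fun α : (Fin n →₀ ℕ) × (Fin n →₀ ℕ) => (α.1, α.2 + Finsupp.single k 1) := by
    rintro k ⟨a, b⟩ ⟨c, d⟩ h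
    simpa using h
  have h1 : ∀ k, ∑ᶠ α, gaussTerm A (uvar R k * U) α₃ α =
      ∑ᶠ α : (Fin n →₀ ℕ) × (Fin n →₀ ℕ),
        gaussTerm A (uvar R k * U) α₃ (α.1, α.2 + Finsupp.single k 1) := by
    intro k
    refine finsum_comp_of_support_subset_range (hinj k) fun α hα => ?_
    refine ⟨(α.1, α.2 - Finsupp.single k 1), Prod.ext rfl (sub_single_add_single fun h => hα ?_)⟩
    rw [gaussTerm, uvar, coeff_X_mul_eq_zero (by simpa using h), zero_mul]
  have h2 : ∀ k, (Function.support fun α : (Fin n →₀ ℕ) × (Fin n →₀ ℕ) =>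
      gaussTerm A (uvar R k * U) α₃ (α.1, α.2 + Finsupp.single k 1)).Finite := fun k =>
    (hU k α₃).preimage (hinj k).injOn
  simp only [h1]
  simp_rw [mul_finsum' _ _ (h2 _)]
  rw [← finsum_sum_comm _ _ fun k _ => (h2 k).subset fun α h hc => h (by simp [hc])]
  simp only [gaussTerm_uvar_mul]
  have h3 : ∀ α : (Fin n →₀ ℕ) × (Fin n →₀ ℕ), ∑ k, A j k *
      (coeff (Finsupp.sumElim α.1 (Finsupp.sumElim α.2 α₃)) U *
        gaussMonomial A α.1 (α.2 + Finsupp.single k 1)) =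
      coeff (Finsupp.sumElim α.1 (Finsupp.sumElim α.2 α₃)) U *
        (α.1 j * gaussMonomial A (α.1 - Finsupp.single j 1) α.2) := fun α => by
    rw [← sum_mul_gaussMonomial A hA, Finset.mul_sum]
    exact Finset.sum_congr rfl fun k _ => by ring
  simp only [h3]
  -- Reindexing by `α₁ ↦ α₁ + single j 1` loses nothing: when `α₁ j = 0`, where the subtraction
  -- truncates, the factor `α₁ j` kills the term.
  rw [finsum_comp_of_support_subset_range (f := fun α : (Fin n →₀ ℕ) × (Fin n →₀ ℕ) =>
      coeff (Finsupp.sumElim α.1 (Finsupp.sumElim α.2 α₃)) U *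
        (α.1 j * gaussMonomial A (α.1 - Finsupp.single j 1) α.2)) (g := fun α : (Fin n →₀ ℕ) × (Fin n →₀ ℕ) =>
    (α.1 + Finsupp.single j 1, α.2))]
  · refine finsum_congr fun α => ?_
    have : Finsupp.sumElim (α.1 + Finsupp.single j 1) (Finsupp.sumElim α.2 α₃) =
      Finsupp.sumElim α.1 (Finsupp.sumElim α.2 α₃) + Finsupp.single (Sum.inl j : Vars n) 1 := by
      ext (i | i | i) <;> simp [Finsupp.single_apply]
    rw [gaussTerm, coeff_pderiv, this]
    simp [mul_assoc]
  · rintro ⟨a, b⟩ ⟨c, d⟩ h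
    simpa using h
  · intro α hα
    refine ⟨(α.1 - Finsupp.single j 1, α.2), Prod.ext (sub_single_add_single fun h => hα ?_) rfl⟩
    simp [h]

end Integral

/-! ### The chain rule, by reduction to finite sums of powers. -/

section ChainRule

variable {R : Type*} [CommRing R] {σ : Type*}

theorem coeff_pow_eq_zero_of_degree_lt {a : MvPowerSeries σ R} (ha : constantCoeff a = 0)
    {d : σ →₀ ℕ} {m : ℕ} (h : d.degree < m) : coeff d (a ^ m) = 0 :=
  coeff_of_lt_order ((Nat.cast_lt.2 h).trans_le (le_order_pow_of_constantCoeff_eq_zero _ ha))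

/-- Chain rule for the substitution of a multivariate power series in a univariate one. -/
theorem pderiv_powerSeries_subst (f : PowerSeries R) {a : MvPowerSeries σ R}
    (ha : constantCoeff a = 0) (i : σ) :
    pderiv R i (f.subst a) = (PowerSeries.derivative R f).subst a * pderiv R i a := by
  classical
  have hs : PowerSeries.HasSubst a := .of_constantCoeff_zero ha
  ext d
  have htrunc : ∀ (g : PowerSeries R) (N : ℕ) (e : σ →₀ ℕ), e.degree < N →
      coeff e (g.subst a) = coeff e (∑ m ∈ Finset.range N, C (PowerSeries.coeff m g) * a ^ m) := by
    intro g N e he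
    rw [PowerSeries.coeff_subst hs, map_sum,
      finsum_eq_sum_of_support_subset (s := Finset.range N)]
    · simp
    · intro m hm
      by_contra hmN
      simp only [Finset.coe_range, Set.mem_Iio, not_lt] at hmN
      exact hm (by simp [coeff_pow_eq_zero_of_degree_lt ha (he.trans_le hmN)])
  -- The coefficient of the derivative at `d` comes from degree `d.degree + 1`, hence the powers
  -- below `d.degree + 2`; differentiation removes one power.
  have hderiv : pderiv R i (∑ m ∈ Finset.range (d.degree + 2), C (PowerSeries.coeff m f) * a ^ m) =
      (∑ m ∈ Finset.range (d.degree + 1),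
        C (PowerSeries.coeff m (PowerSeries.derivative R f)) * a ^ m) * pderiv R i a := by
    have hzero : pderiv R i (C (PowerSeries.coeff 0 f) * a ^ 0) = 0 := by
      rw [pow_zero, mul_one, pderiv_C]
    rw [Finset.sum_range_succ', map_add, hzero, add_zero, map_sum (pderiv R i), Finset.sum_mul]
    refine Finset.sum_congr rfl fun m _ => ?_
    rw [Derivation.leibniz, pderiv_pow, pderiv_C, PowerSeries.coeff_derivative, smul_zero,
      add_zero, smul_eq_mul, map_mul, Nat.add_sub_cancel]
    push_cast
    rw [map_add, map_one, map_natCast]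
    ring
  rw [coeff_pderiv, htrunc f (d.degree + 2) _ (by simp), ← coeff_pderiv, hderiv, coeff_mul,
    coeff_mul]
  refine Finset.sum_congr rfl fun x hx => ?_
  rw [htrunc _ (d.degree + 1)]
  rw [← Finset.HasAntidiagonal.mem_antidiagonal.1 hx, map_add]
  omega

end ChainRule

/-! ### The weight grading and summability. -/

section Weight

variable {R : Type*} [CommRing R] {n : ℕ} {A : Matrix (Fin n) (Fin n) R}
  {U V : MvPowerSeries (Vars n) R} {k l : ℤ}

/-- The weight of a monomial, where `ū`, `u`, `Y` have weight `-2`, `1`, `2`. -/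
noncomputable def monWeight (n : ℕ) : (Vars n →₀ ℕ) →+ ℤ :=
  Finsupp.weight (Sum.elim (fun _ => -2) (Sum.elim (fun _ => 1) fun _ => 2))

/-- All monomials of `U` have weight at least `k`. -/
def WeightGE (k : ℤ) (U : MvPowerSeries (Vars n) R) : Prop :=
  ∀ d, coeff d U ≠ 0 → k ≤ monWeight n d

theorem monWeight_sumElim (α₁ α₂ α₃ : Fin n →₀ ℕ) :
    monWeight n (Finsupp.sumElim α₁ (Finsupp.sumElim α₂ α₃)) =
      -2 * α₁.degree + α₂.degree + 2 * α₃.degree := by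
  rw [monWeight, Finsupp.weight_apply, Finsupp.sum_fintype _ _ (by simp)]
  simp [Finsupp.degree_eq_sum, Finset.mul_sum, mul_comm]
  ring

theorem monWeight_single (x : Vars n) (m : ℕ) : monWeight n (Finsupp.single x m) =
    m * Sum.elim (fun _ => -2) (Sum.elim (fun _ => 1) fun _ => 2) x := by
  simp [monWeight, Finsupp.weight_apply]

theorem WeightGE.add (hU : WeightGE k U) (hV : WeightGE k V) : WeightGE k (U + V) := by
  intro d hd
  by_cases h : coeff d U = 0
  · exact hV d fun h' => hd (by rw [map_add, h, h', add_zero])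
  · exact hU d h

theorem WeightGE.sum {ι : Type*} {s : Finset ι} {f : ι → MvPowerSeries (Vars n) R}
    (h : ∀ i ∈ s, WeightGE k (f i)) : WeightGE k (∑ i ∈ s, f i) := by
  intro d hd
  rw [map_sum] at hd
  obtain ⟨i, hi, hne⟩ := Finset.exists_ne_zero_of_sum_ne_zero hd
  exact h i hi d hne

theorem WeightGE.mul (hU : WeightGE k U) (hV : WeightGE l V) : WeightGE (k + l) (U * V) := by
  classical
  intro d hd
  rw [coeff_mul] at hd
  obtain ⟨x, hx, hne⟩ := Finset.exists_ne_zero_of_sum_ne_zero hd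
  rw [← Finset.HasAntidiagonal.mem_antidiagonal.1 hx, map_add]
  exact add_le_add (hU _ (left_ne_zero_of_mul hne)) (hV _ (right_ne_zero_of_mul hne))

theorem weightGE_one : WeightGE 0 (1 : MvPowerSeries (Vars n) R) := by
  classical
  intro d hd
  rw [coeff_one] at hd
  obtain rfl : d = 0 := by by_contra h; simp [h] at hd
  simp

theorem WeightGE.pow (hU : WeightGE 0 U) (m : ℕ) : WeightGE 0 (U ^ m) := by
  induction m with
  | zero => simpa using weightGE_one
  | succ m ih => simpa [pow_succ] using ih.mul hU

theorem weightGE_X (x : Vars n) :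
    WeightGE (Sum.elim (fun _ => -2) (Sum.elim (fun _ => 1) fun _ => 2) x)
      (X x : MvPowerSeries (Vars n) R) := by
  classical
  intro d hd
  rw [coeff_X] at hd
  obtain rfl : d = Finsupp.single x 1 := by by_contra h; simp [h] at hd
  simp [monWeight_single]

theorem weightGE_ubar (i : Fin n) : WeightGE (-2) (ubar R i) := weightGE_X (Sum.inl i)

theorem weightGE_uvar (i : Fin n) : WeightGE 1 (uvar R i) := weightGE_X (Sum.inr (Sum.inl i))

theorem weightGE_yvar (i : Fin n) : WeightGE 2 (yvar R i) := weightGE_X (Sum.inr (Sum.inr i))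

theorem WeightGE.powerSeries_subst (hU : WeightGE 0 U) (hc : constantCoeff U = 0)
    (f : PowerSeries R) : WeightGE 0 (f.subst U) := by
  intro d hd
  rw [PowerSeries.coeff_subst (.of_constantCoeff_zero hc)] at hd
  obtain ⟨m, hm⟩ := not_forall.1 (mt finsum_eq_zero_of_forall_eq_zero hd)
  exact hU.pow m d (right_ne_zero_of_smul hm)

theorem constantCoeff_uvar (i : Fin n) : constantCoeff (uvar R i) = 0 := by simp [uvar]

theorem hasSubst_uvar : HasSubst (uvar R : Fin n → MvPowerSeries (Vars n) R) :=
  hasSubst_of_constantCoeff_zero constantCoeff_uvar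

theorem prod_uvar_pow (e : Fin n →₀ ℕ) :
    (e.prod fun i m => uvar R i ^ m) =
      monomial (Finsupp.sumElim (0 : Fin n →₀ ℕ) (Finsupp.sumElim e (0 : Fin n →₀ ℕ))) 1 := by
  induction e using Finsupp.induction_linear with
  | zero => simp
  | add f g hf hg =>
    rw [Finsupp.prod_add_index' (by simp) (by simp [pow_add]), hf, hg, monomial_mul_monomial,
      one_mul]
    congr 2
    ext (i | i | i) <;> simp
  | single i m =>
    rw [Finsupp.prod_single_index (by simp), uvar, X_pow_eq]
    simp

/-- Monomials of `Q(u)` involve only the `u`'s. This yields both the weight bound and the vanishing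
of the `ū`-derivatives. -/
theorem exists_of_coeff_subst_uvar_ne_zero {Q : MvPowerSeries (Fin n) R} {d : Vars n →₀ ℕ}
    (h : coeff d (Q.subst (uvar R : Fin n → MvPowerSeries (Vars n) R)) ≠ 0) :
    ∃ e, coeff e Q ≠ 0 ∧
      d = Finsupp.sumElim (0 : Fin n →₀ ℕ) (Finsupp.sumElim e (0 : Fin n →₀ ℕ)) := by
  classical
  rw [coeff_subst hasSubst_uvar] at h
  obtain ⟨e, he⟩ := not_forall.1 (mt finsum_eq_zero_of_forall_eq_zero h)
  refine ⟨e, left_ne_zero_of_smul he, ?_⟩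
  have h' := right_ne_zero_of_smul he
  rw [prod_uvar_pow, coeff_monomial] at h'
  by_contra hne
  simp [hne] at h'

theorem weightGE_subst_uvar {Q : MvPowerSeries (Fin n) R} {m : ℕ}
    (hQ : Q ∈ orderIdeal R (Fin n) m) :
    WeightGE m (Q.subst (uvar R : Fin n → MvPowerSeries (Vars n) R)) := by
  intro d hd
  obtain ⟨e, he, rfl⟩ := exists_of_coeff_subst_uvar_ne_zero hd
  rw [monWeight_sumElim]
  have : m ≤ e.degree := by exact_mod_cast (mem_orderIdeal.1 hQ).trans (order_le he)
  simpa using this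

theorem pderiv_inl_subst_uvar (Q : MvPowerSeries (Fin n) R) (j : Fin n) :
    pderiv R (Sum.inl j) (Q.subst (uvar R : Fin n → MvPowerSeries (Vars n) R)) = 0 := by
  ext d
  rw [coeff_pderiv, map_zero]
  by_contra h
  obtain ⟨e, -, he⟩ := exists_of_coeff_subst_uvar_ne_zero (left_ne_zero_of_mul h)
  simpa using DFunLike.congr_fun he (Sum.inl j)

/-- Without a bijection the Wick sum is empty, so the degrees in `ū` and `u` agree; the weight is
then `-|α₁| + 2|α₃|`, which bounds `|α₁|` in terms of `α₃`. -/
theorem WeightGE.le_of_gaussTerm_ne_zero (hU : WeightGE k U) {α₃ : Fin n →₀ ℕ}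
    {α : (Fin n →₀ ℕ) × (Fin n →₀ ℕ)} (h : gaussTerm A U α₃ α ≠ 0) :
    α.1.degree = α.2.degree ∧ k + α.1.degree ≤ 2 * α₃.degree := by
  have hdeg : α.1.degree = α.2.degree := by
    by_contra hne
    exact h (by rw [gaussTerm, gaussMonomial_eq_zero hne, mul_zero])
  have hw := hU _ (left_ne_zero_of_mul h)
  rw [monWeight_sumElim] at hw
  exact ⟨hdeg, by omega⟩

theorem WeightGE.gaussSummable (hU : WeightGE k U) : GaussSummable A U := by
  intro α₃
  have hfin := Finsupp.finite_of_degree_le (σ := Fin n) (2 * α₃.degree - k).toNat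
  refine (hfin.prod hfin).subset fun α hα => ?_
  obtain ⟨h1, h2⟩ := hU.le_of_gaussTerm_ne_zero hα
  simp only [Set.mem_prod, Set.mem_ofPred_eq]
  omega

/-- Continuity of the integral: integrands of high weight affect only high degrees in `Y`. -/
theorem WeightGE.coeff_gaussIntegral_eq_zero (hU : WeightGE k U) {α₃ : Fin n →₀ ℕ}
    (h : 2 * (α₃.degree : ℤ) < k) : coeff α₃ (gaussIntegral A U) = 0 := by
  rw [coeff_gaussIntegral]
  refine finsum_eq_zero_of_forall_eq_zero fun α => ?_
  by_contra hα
  have := (hU.le_of_gaussTerm_ne_zero hα).2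
  omega

end Weight

/-! ### Schwinger–Dyson equation, moments and the normalising integral. -/

section Main

variable {R : Type*} [CommRing R] {n : ℕ} {F : Fin n → MvPowerSeries (Fin n) R}

theorem subst_mem_orderIdeal {σ τ : Type*} [Finite σ] {Q : MvPowerSeries σ R}
    {a : σ → MvPowerSeries τ R} (ha : ∀ i, constantCoeff (a i) = 0) {m : ℕ}
    (hQ : Q ∈ orderIdeal R σ m) : Q.subst a ∈ orderIdeal R τ m := by
  refine nat_le_order fun d hd => ?_
  rw [coeff_subst (hasSubst_of_constantCoeff_zero ha)]
  refine finsum_eq_zero_of_forall_eq_zero fun e => ?_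
  by_cases he : coeff e Q = 0
  · rw [he, zero_smul]
  have hm : (m : ℕ∞) ≤ e.degree := (mem_orderIdeal.1 hQ).trans (order_le he)
  rw [coeff_of_lt_order (f := e.prod _), smul_zero]
  exact (Nat.cast_lt.2 hd).trans_le (hm.trans (prod_pow_mem_orderIdeal ha e))

theorem constantCoeff_interaction (F : Fin n → MvPowerSeries (Fin n) R) :
    constantCoeff (interaction F) = 0 := by
  simp [interaction, ubar]

/-- The weights are chosen for this: `H_i` has order at least two, so `ū_i H_i(u)` has weight at
least `-2 + 2`, and `ū_i Y_i` has weight exactly `0`. -/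
theorem weightGE_interaction (F : Fin n → MvPowerSeries (Fin n) R) :
    WeightGE 0 (interaction F) := by
  refine WeightGE.add (WeightGE.sum fun i _ => ?_) (WeightGE.sum fun i _ => ?_)
  · exact (weightGE_ubar i).mul (weightGE_subst_uvar (m := 2) (nonlinPart_mem_orderIdeal F i))
  · exact (weightGE_ubar i).mul (weightGE_yvar i)

theorem pderiv_inl_interaction (F : Fin n → MvPowerSeries (Fin n) R) (j : Fin n) :
    pderiv R (Sum.inl j) (interaction F) = (nonlinPart F j).subst (uvar R) + yvar R j := by
  classical
  simp [interaction, Derivation.leibniz, pderiv_inl_subst_uvar, ubar, yvar, pderiv_X,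
    Pi.single_apply]

variable [Algebra ℚ R]

theorem weightGE_expInteraction (F : Fin n → MvPowerSeries (Fin n) R) :
    WeightGE 0 (expInteraction F) :=
  (weightGE_interaction F).powerSeries_subst (constantCoeff_interaction F) _

theorem pderiv_inl_expInteraction (F : Fin n → MvPowerSeries (Fin n) R) (j : Fin n) :
    pderiv R (Sum.inl j) (expInteraction F) =
      ((nonlinPart F j).subst (uvar R) + yvar R j) * expInteraction F := by
  rw [expInteraction, pderiv_powerSeries_subst _ (constantCoeff_interaction F),
    PowerSeries.derivative_exp, pderiv_inl_interaction, mul_comm]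

/-- The formal Gaussian integral of `Q(u) exp (ūH(u) + ūY)`. -/
noncomputable def gaussMoment (F : Fin n → MvPowerSeries (Fin n) R) (Q : MvPowerSeries (Fin n) R) :
    MvPowerSeries (Fin n) R :=
  gaussIntegral (linMatrix F) (Q.subst (uvar R) * expInteraction F)

theorem weightGE_subst_uvar_mul_exp {Q : MvPowerSeries (Fin n) R} {m : ℕ}
    (hQ : Q ∈ orderIdeal R (Fin n) m) : WeightGE m (Q.subst (uvar R) * expInteraction F) := by
  simpa using (weightGE_subst_uvar hQ).mul (weightGE_expInteraction F)

theorem gaussSummable_subst_uvar_mul_exp (Q : MvPowerSeries (Fin n) R) :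
    GaussSummable (linMatrix F) (Q.subst (uvar R) * expInteraction F) :=
  (weightGE_subst_uvar_mul_exp (m := 0) (by simp [mem_orderIdeal])).gaussSummable

theorem gaussMoment_add (P Q : MvPowerSeries (Fin n) R) :
    gaussMoment F (P + Q) = gaussMoment F P + gaussMoment F Q := by
  rw [gaussMoment, subst_add hasSubst_uvar, add_mul,
    gaussIntegral_add (gaussSummable_subst_uvar_mul_exp P) (gaussSummable_subst_uvar_mul_exp Q)]
  rfl

theorem gaussMoment_C_mul (r : R) (Q : MvPowerSeries (Fin n) R) :
    gaussMoment F (C r * Q) = C r * gaussMoment F Q := by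
  rw [gaussMoment, subst_mul hasSubst_uvar, subst_C, mul_assoc,
    gaussIntegral_C_mul (gaussSummable_subst_uvar_mul_exp Q), gaussMoment]

theorem gaussMoment_sum {ι : Type*} (s : Finset ι) (f : ι → MvPowerSeries (Fin n) R) :
    gaussMoment F (∑ i ∈ s, f i) = ∑ i ∈ s, gaussMoment F (f i) :=
  map_sum (AddMonoidHom.mk' (gaussMoment F) gaussMoment_add) f s

theorem coeff_gaussMoment_eq_zero {Q : MvPowerSeries (Fin n) R} {m : ℕ}
    (hQ : Q ∈ orderIdeal R (Fin n) m) {α₃ : Fin n →₀ ℕ} (h : 2 * α₃.degree < m) :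
    coeff α₃ (gaussMoment F Q) = 0 :=
  (weightGE_subst_uvar_mul_exp hQ).coeff_gaussIntegral_eq_zero (by exact_mod_cast h)

/-- The Schwinger–Dyson equation: under the integral, `F_j(u)` acts as `Y_j`. -/
theorem gaussMoment_mul_left (hF : ∀ i, constantCoeff (F i) = 0) (hA : IsUnit (linMatrix F))
    (j : Fin n) (Q : MvPowerSeries (Fin n) R) :
    gaussMoment F (F j * Q) = X j * gaussMoment F Q := by
  have hX : ∀ k, uvar R k * (Q.subst (uvar R) * expInteraction F) =
      (X k * Q).subst (uvar R) * expInteraction F := fun k => by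
    rw [subst_mul hasSubst_uvar, subst_X hasSubst_uvar, mul_assoc]
  have hparts := gaussIntegral_pderiv (U := Q.subst (uvar R) * expInteraction F) hA j
    fun k => by rw [hX]; exact gaussSummable_subst_uvar_mul_exp _
  -- The linear form `Au` is split as `F(u) + H(u)`; the `H` part will cancel against the derivative
  -- of the exponential.
  have hlin : ∑ k, C (linMatrix F j k) * gaussIntegral (linMatrix F)
      (uvar R k * (Q.subst (uvar R) * expInteraction F)) =
      gaussMoment F (F j * Q) + gaussMoment F (nonlinPart F j * Q) := by
    rw [← gaussMoment_add, ← add_mul]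
    conv_rhs => rw [eq_linPart_sub_nonlinPart F hF j, sub_add_cancel, linPart, Finset.sum_mul,
      gaussMoment_sum]
    exact Finset.sum_congr rfl fun k _ => by rw [hX, mul_assoc, gaussMoment_C_mul, gaussMoment]
  have hderiv : pderiv R (Sum.inl j) (Q.subst (uvar R) * expInteraction F) =
      (nonlinPart F j * Q).subst (uvar R) * expInteraction F +
        yvar R j * (Q.subst (uvar R) * expInteraction F) := by
    rw [Derivation.leibniz, pderiv_inl_subst_uvar, pderiv_inl_expInteraction,
      subst_mul hasSubst_uvar, smul_zero, smul_eq_mul]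
    ring
  have hY : GaussSummable (linMatrix F) (yvar R j * (Q.subst (uvar R) * expInteraction F)) :=
    ((weightGE_yvar j).mul (weightGE_subst_uvar_mul_exp (m := 0)
      (by simp [mem_orderIdeal]))).gaussSummable
  rw [hlin, hderiv, gaussIntegral_add (gaussSummable_subst_uvar_mul_exp _) hY,
    gaussIntegral_yvar_mul, ← gaussMoment, ← gaussMoment, add_comm] at hparts
  exact (add_right_cancel hparts).symm

theorem gaussMoment_aeval (hF : ∀ i, constantCoeff (F i) = 0) (hA : IsUnit (linMatrix F))
    (p : MvPolynomial (Fin n) R) :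
    gaussMoment F (MvPolynomial.aeval F p) = p * gaussMoment F 1 := by
  induction p using MvPolynomial.induction_on with
  | C a =>
    have h := gaussMoment_C_mul (F := F) a 1
    rw [mul_one] at h
    rw [MvPolynomial.aeval_C, MvPolynomial.coe_C]; exact h
  | add p q hp hq => rw [map_add, gaussMoment_add, hp, hq, MvPolynomial.coe_add, add_mul]
  | mul_X p i hp =>
    rw [map_mul, MvPolynomial.aeval_X, mul_comm, gaussMoment_mul_left hF hA, hp,
      MvPolynomial.coe_mul, MvPolynomial.coe_X]
    ring

/-- Compared coefficient by coefficient: a truncation of `Q` is a polynomial, covered by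
`gaussMoment_aeval`, and the remainder is invisible at `α₃` on both sides. -/
theorem gaussMoment_subst (hF : ∀ i, constantCoeff (F i) = 0) (hA : IsUnit (linMatrix F))
    (Q : MvPowerSeries (Fin n) R) :
    gaussMoment F (Q.subst F) = Q * gaussMoment F 1 := by
  ext α₃
  -- The least order at which `coeff_gaussMoment_eq_zero` applies to `α₃`.
  set N := 2 * α₃.degree + 1 with hN
  set p := truncTotal N Q with hp
  obtain ⟨r, hr⟩ : ∃ r, r = Q - (p : MvPowerSeries (Fin n) R) := ⟨_, rfl⟩
  have hrN : r ∈ orderIdeal R (Fin n) N := nat_le_order fun d hd => by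
    rw [hr, map_sub, MvPolynomial.coeff_coe, hp, coeff_truncTotal _ hd, sub_self]
  have hQ : Q = p + r := by rw [hr]; ring
  have hs := hasSubst_of_constantCoeff_zero hF
  rw [hQ, subst_add hs, subst_coe, gaussMoment_add, gaussMoment_aeval hF hA, add_mul, map_add,
    map_add, coeff_gaussMoment_eq_zero (subst_mem_orderIdeal hF hrN) (by omega)]
  congr 1
  refine (coeff_of_lt_order ?_).symm
  refine lt_of_lt_of_le (Nat.cast_lt.2 (by omega : α₃.degree < N)) ?_
  exact Ideal.mul_mem_right _ _ hrN

theorem gaussMoment_one : gaussMoment F 1 = gaussIntegral (linMatrix F) (expInteraction F) := by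
  rw [gaussMoment, ← substAlgHom_apply hasSubst_uvar, map_one, one_mul]

theorem gaussMoment_X (i : Fin n) :
    gaussMoment F (X i) = gaussIntegral (linMatrix F) (uvar R i * expInteraction F) := by
  rw [gaussMoment, subst_X hasSubst_uvar]

theorem constantCoeff_expInteraction (F : Fin n → MvPowerSeries (Fin n) R) :
    constantCoeff (expInteraction F) = 1 := by
  rw [expInteraction, PowerSeries.constantCoeff_subst
    (.of_constantCoeff_zero (constantCoeff_interaction F)), finsum_eq_single _ 0]
  · simp
  · intro m hm
    simp [constantCoeff_interaction, hm]

/-- At `α₃ = 0` the weight bound forces `α₁ = α₂ = 0`, leaving the single empty bijection with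
product `1`. -/
theorem constantCoeff_gaussIntegral_exp (F : Fin n → MvPowerSeries (Fin n) R) :
    constantCoeff (gaussIntegral (linMatrix F) (expInteraction F)) =
      Ring.inverse (linMatrix F).det := by
  rw [← coeff_zero_eq_constantCoeff_apply, coeff_gaussIntegral, finsum_eq_single _ 0]
  · have h0 : Finsupp.sumElim (0 : Fin n →₀ ℕ)
        (Finsupp.sumElim (0 : Fin n →₀ ℕ) (0 : Fin n →₀ ℕ)) = 0 := by
      ext (i | i | i) <;> simp
    rw [gaussTerm, Prod.fst_zero, Prod.snd_zero, h0, coeff_zero_eq_constantCoeff_apply,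
      constantCoeff_expInteraction, one_mul,
      gaussMonomial_eq (k₁ := 0) (k₂ := 0) _ _ _ Fin.elim0 Fin.elim0 (by simp) (by simp)]
    simp [wickSum]
  · intro α hα
    by_contra h
    obtain ⟨h1, h2⟩ := (weightGE_expInteraction F).le_of_gaussTerm_ne_zero h
    simp only [map_zero] at h2
    exact hα (Prod.ext ((Finsupp.degree_eq_zero_iff _).1 (by omega))
      ((Finsupp.degree_eq_zero_iff _).1 (by omega)))

theorem isUnit_gaussIntegral_exp (hA : IsUnit (linMatrix F)) :
    IsUnit (gaussIntegral (linMatrix F) (expInteraction F)) := by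
  rw [isUnit_iff_constantCoeff, constantCoeff_gaussIntegral_exp]
  exact ((Matrix.isUnit_iff_isUnit_det _).1 hA).ringInverse

end Main

end FormalGauss

open FormalGauss

theorem theorem5 {R : Type*} [CommRing R] [Algebra ℚ R] (n : ℕ)
    (F : Fin n → MvPowerSeries (Fin n) R)
    (hF : ∀ i, MvPowerSeries.constantCoeff (F i) = 0)
    (hA : IsUnit (FormalGauss.linMatrix F)) :
    (∀ i, FormalGauss.GaussSummable (FormalGauss.linMatrix F)
      (FormalGauss.uvar R i * FormalGauss.expInteraction F)) ∧
    FormalGauss.GaussSummable (FormalGauss.linMatrix F) (FormalGauss.expInteraction F) ∧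
    IsUnit (FormalGauss.gaussIntegral (FormalGauss.linMatrix F)
      (FormalGauss.expInteraction F)) ∧
    ∃ G : Fin n → MvPowerSeries (Fin n) R,
      FormalGauss.IsCompInverse F G ∧
      (∀ G', FormalGauss.IsCompInverse F G' → G' = G) ∧
      ∀ i, G i =
        FormalGauss.gaussIntegral (FormalGauss.linMatrix F)
            (FormalGauss.uvar R i * FormalGauss.expInteraction F) *
          Ring.inverse (FormalGauss.gaussIntegral (FormalGauss.linMatrix F)
            (FormalGauss.expInteraction F)) := by
  have hunit := isUnit_gaussIntegral_exp hA
  obtain ⟨G, hG⟩ := exists_isCompInverse hF hA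
  refine ⟨fun i => ((weightGE_uvar i).mul (weightGE_expInteraction F)).gaussSummable,
    (weightGE_expInteraction F).gaussSummable, hunit, G, hG,
    fun G' hG' => hG.eq_of_isUnit_linMatrix hA hG', fun i => ?_⟩
  -- Here `X i` is rewritten as `G_i(F)`, so the numerator becomes `G_i` times the denominator.
  rw [← gaussMoment_X, ← hG.comp_right i, gaussMoment_subst hF hA, gaussMoment_one, mul_assoc,
    Ring.mul_inverse_cancel _ hunit, mul_one]
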